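/- Let $\mathcal H$ be a real Hilbert space, let $A,B:\mathcal H\to 2^{\mathcal H}$ be maximal monotone operators, and let $C:\mathcal H\to\mathcal H$ be $\beta$-cocoercive with $\beta>0$, i.e. $\langle Cx-Cy,x-y\rangle\ge\beta\|Cx-Cy\|^2$ for all $x,y$. For $\gamma>0$ let $J_{\gamma A}=(I+\gamma A)^{-1}$ and $J_{\gamma B}=(I+\gamma B)^{-1}$ be the resolvents and put $$T=I-J_{\gamma B}+J_{\gamma A}\circ(2J_{\gamma B}-I-\gamma C\circ J_{\gamma B}).$$ Let $\varepsilon\in(0,1)$, $\gamma\in(0,2\beta\varepsilon)$, $\alpha=1/(2-\varepsilon)$, and suppose $\operatorname{Fix}T\neq\emptyset$. Let $\lambda_k\in(0,1/\alpha)$ $(k\ge0)$ be such that, with $\tau_k=(1-\alpha\lambda_k)\lambda_k/\alpha$, one has $\sum_{k\ge0}\tau_k=\infty$. Let $z^0\in\mathcal H$ be arbitrary and, for $k\ge0$, $$z^{k+1}=z^k+\lambda_k(Tz^k-z^k),\qquad x_B^k=J_{\gamma B}(z^k),\qquad x_A^k=J_{\gamma A}(2x_B^k-z^k-\gamma Cx_B^k).$$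 Write $\operatorname{zer}(A+B+C)=\{x: 0\in Ax+Bx+Cx\}$. Then: 1. For every $z^*\in\operatorname{Fix}T$ the sequence $(\|z^k-z^*\|)_{k\ge0}$ is nonincreasing. 2. The sequence $(\|Tz^k-z^k\|)_{k\ge0}$ is nonincreasing and converges to $0$. 3. $(z^k)$ converges weakly to a fixed point of $T$. 4. If $\inf_k\lambda_k>0$, then for every $x^*\in\operatorname{zer}(A+B+C)$ and every $z^*\in\operatorname{Fix}T$, $$\sum_{k=0}^\infty\lambda_k\|Cx_B^k-Cx^*\|^2\le\frac{1}{\gamma(2\beta-\gamma/\varepsilon)}\|z^0-z^*\|^2<\infty,$$ and $Cx_B^k\to Cx^*$ strongly. 5. If $\inf_k\lambda_k>0$ and $z^*$ is the weak limit of $(z^k)$, then $J_{\gamma B}(z^*)\in\operatorname{zer}(A+B+C)$ and $x_B^k\rightharpoonup J_{\gamma B}(z^*)$. 6. Under the same assumptions, $x_A^k\rightharpoonup J_{\gamma B}(z^*)\in\operatorname{zer}(A+B+C)$. 7. If $\underline\tau:=\inf_k\tau_k>0$, then for every $z^*\in\operatorname{Fix}T$ and every $k\ge0$, $$\|Tz^k-z^k\|^2\le\frac{\|z^0-z^*\|^2}{\underline\tau\,(k+1)},\qquad\text{and}\qquad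 \|Tz^k-z^k\|^2=o\!\left(\frac1{k+1}\right).$$ 8. Let $z^*$ be the weak limit of $(z^k)$. Then $J_{\gamma B}(z^*)\in\operatorname{zer}(A+B+C)$ and both $(x_B^k)$ and $(x_A^k)$ converge strongly to $J_{\gamma B}(z^*)$ whenever one of the following holds: (a) $A$ is uniformly monotone on every nonempty bounded subset of its domain $\operatorname{dom}A=\{x:Ax\ne\emptyset\}$; (b) $B$ is uniformly monotone on every nonempty bounded subset of its domain; (c) $C$ is demiregular at every $x\in\operatorname{zer}(A+B+C)$. Here an operator $S$ is uniformly monotone on a set $D$ if there is a nondecreasing $\phi:[0,\infty)\to[0,\infty]$ vanishing only at $0$ with $\langle x-y,u-v\rangle\ge\phi(\|x-y\|)$ for all $x,y\in D$, $u\in Sx$, $v\in Sy$; and $C$ is demiregular at $x$ if $x^k\rightharpoonup x$ and $Cx^k\to Cx$ imply $x^k\to x$. -/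

import Mathlib

open Filter Topology Asymptotics
open scoped Pointwise NNReal ENNReal

namespace MonotoneSplitting

noncomputable section

variable {H : Type*} [NormedAddCommGroup H] [InnerProductSpace ℝ H]

/-- The graph of a set-valued operator. -/
def gra (S : H → Set H) : Set (H × H) := {p | p.2 ∈ S p.1}

/-- The domain of a set-valued operator. -/
def dom (S : H → Set H) : Set H := {x | (S x).Nonempty}

/-- The zeros of a set-valued operator. -/
def zer (S : H → Set H) : Set H := {x | 0 ∈ S x}

/-- A map seen as a (single-valued) set-valued operator. -/
def single (C : H → H) : H → Set H := fun x => {C x}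

/-- Monotone set-valued operators. -/
def IsMonotoneOp (S : H → Set H) : Prop :=
  ∀ x y, ∀ u ∈ S x, ∀ v ∈ S y, 0 ≤ inner ℝ (x - y) (u - v)

/-- Maximal monotone operators: monotone, and the graph is not properly contained in the graph
of another monotone operator. -/
def IsMaximalMonotone (S : H → Set H) : Prop :=
  IsMonotoneOp S ∧ ∀ S' : H → Set H, IsMonotoneOp S' → ¬ gra S ⊂ gra S'

/-- `β`-cocoercive maps. -/
def IsCocoercive (β : ℝ) (C : H → H) : Prop :=
  ∀ x y, β * ‖C x - C y‖ ^ 2 ≤ inner ℝ (C x - C y) (x - y)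

/-- The inverse of a set-valued operator. -/
def inverseOp (S : H → Set H) : H → Set H := fun y => {x | y ∈ S x}

/-- The resolvent `(I + S)⁻¹`, as a set-valued operator. -/
def resolventOp (S : H → Set H) : H → Set H := inverseOp (single id + S)

/-- The resolvent `J_S = (I + S)⁻¹` as a map: `resolventMap S z` is a point of `(I + S)⁻¹ z`
whenever there is one (for a maximal monotone `S` there is always exactly one). -/
def resolventMap (S : H → Set H) : H → H := fun z => Classical.epsilon (fun x => x ∈ resolventOp S z)

/-- The map `z ↦ x_B`, that is `J_{γB}`. -/
def stepB (γ : ℝ) (B : H → Set H) : H → H := resolventMap (γ • B)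

/-- The map `z ↦ x_A`, that is `J_{γA} ∘ (2 J_{γB} - I - γ C ∘ J_{γB})`. -/
def stepA (γ : ℝ) (A B : H → Set H) (C : H → H) : H → H := fun z =>
  resolventMap (γ • A) ((2 : ℝ) • resolventMap (γ • B) z - z - γ • C (resolventMap (γ • B) z))

/-- The three-operator splitting map
`T = I - J_{γB} + J_{γA} ∘ (2 J_{γB} - I - γ C ∘ J_{γB})`. -/
def splittingMap (γ : ℝ) (A B : H → Set H) (C : H → H) : H → H := fun z =>
  z - stepB γ B z + stepA γ A B C z

/-- Weak convergence of a sequence. -/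
def WeaklyTendsto (u : ℕ → H) (x : H) : Prop :=
  Tendsto (fun k => toWeakSpace ℝ H (u k)) atTop (𝓝 (toWeakSpace ℝ H x))

/-- `S` is uniformly monotone on the set `D`, with some modulus `φ : [0, ∞) → [0, ∞]` that is
increasing (in the wide sense) and vanishes only at `0`. -/
def UniformlyMonotoneOn (S : H → Set H) (D : Set H) : Prop :=
  ∃ φ : ℝ≥0 → ℝ≥0∞, Monotone φ ∧ (∀ t, φ t = 0 ↔ t = 0) ∧
    ∀ x ∈ D, ∀ y ∈ D, ∀ u ∈ S x, ∀ v ∈ S y,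
      ((φ ‖x - y‖₊ : ℝ≥0∞) : EReal) ≤ ((inner ℝ (x - y) (u - v) : ℝ) : EReal)

/-- `S` is uniformly monotone on every nonempty bounded subset of its domain. -/
def UniformlyMonotoneOnBounded (S : H → Set H) : Prop :=
  ∀ D : Set H, D.Nonempty → Bornology.IsBounded D → D ⊆ dom S → UniformlyMonotoneOn S D

/-- `S` is demiregular at `x`. -/
def DemiregularAt (S : H → Set H) (x : H) : Prop :=
  ∀ u ∈ S x, ∀ (xs us : ℕ → H), (∀ k, (xs k, us k) ∈ gra S) →
    WeaklyTendsto xs x → Tendsto us atTop (𝓝 u) → Tendsto xs atTop (𝓝 x)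

end

end MonotoneSplitting

open MonotoneSplitting

/-! Everything rests on one inequality, `splitting_energy`. For two points, it bounds by their
squared distance the sum of four terms: the squared distance of their images under the splitting map
`T`, and multiples of the squared difference of residuals, of the squared difference of the values
of `C`, and of the monotonicity products of `A` and `B`.

Discarding the last two kinds of term shows that `T` is averaged, so the iteration is a
Krasnoselskii–Mann scheme. It is Fejér monotone, its residual decreases, and the residual vanishes
because the `τ k` have infinite sum. Demiclosedness of `I - T` and Opial's lemma then give a weak
limit.

Against a fixed point `p`, the gap `‖z k - p‖ ^ 2 - ‖T (z k) - p‖ ^ 2` is at most a constant times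
the residual. Hence the discarded terms tend to zero as well: `C` converges strongly along `x_B`,
and the monotonicity products vanish, which is what uniform monotonicity and demiregularity turn
into strong convergence.

Weak convergence of `x_B` is not automatic, since resolvents need not be weakly continuous.
`weakLim_stepB` obtains it by testing the graphs of `A` and `B` simultaneously, so that the products
of two merely weakly convergent sequences cancel. Resolvents are defined everywhere by Minty's
theorem, here derived from a convex maximization argument. -/

namespace MonotoneSplitting

/-! ### Minty's theorem and resolvents -/

section Minty

variable {H : Type*} [NormedAddCommGroup H] [InnerProductSpace ℝ H]

open InnerProductSpace

/-- A convex set below the paraboloid `p = ‖x‖ ^ 2` lies below one of its tangent hyperplanes. -/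
theorem exists_tangent_above_of_convex [CompleteSpace H] {K : Set (H × ℝ)} (hK : Convex ℝ K)
    (hle : ∀ k ∈ K, k.2 ≤ ‖k.1‖ ^ 2) :
    ∃ y : H, ∀ k ∈ K, k.2 - 2 * ⟪y, k.1⟫_ℝ + ‖y‖ ^ 2 ≤ 0 := by
  rcases K.eq_empty_or_nonempty with rfl | hne
  · exact ⟨0, by simp⟩
  set g : H × ℝ → ℝ := fun k => k.2 - ‖k.1‖ ^ 2 with hg
  have hbdd : BddAbove (g '' K) := by
    refine ⟨0, ?_⟩
    rintro _ ⟨k, hk, rfl⟩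
    have := hle k hk
    simp only [hg]; linarith
  set m := sSup (g '' K) with hm
  have hgm : ∀ k ∈ K, g k ≤ m := fun k hk => le_csSup hbdd ⟨k, hk, rfl⟩
  have hm0 : m ≤ 0 := by
    refine csSup_le (hne.image g) ?_
    rintro _ ⟨k, hk, rfl⟩
    have := hle k hk
    simp only [hg]; linarith
  have happ : ∀ n : ℕ, ∃ k ∈ K, m - 1 / ((n : ℝ) + 1) < g k := by
    intro n
    have hpos : (0 : ℝ) < 1 / ((n : ℝ) + 1) := by positivity
    obtain ⟨_, ⟨k, hk, rfl⟩, h⟩ :=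
      exists_lt_of_lt_csSup (hne.image g) (show m - 1 / ((n : ℝ) + 1) < sSup (g '' K) by linarith)
    exact ⟨k, hk, h⟩
  choose k hkK hkg using happ
  have hcomb : ∀ P ∈ K, ∀ Q ∈ K, ∀ t : ℝ, 0 ≤ t → t ≤ 1 →
      P.2 + t * (Q.2 - P.2) - (‖P.1‖ ^ 2 + 2 * t * ⟪P.1, Q.1 - P.1⟫_ℝ + t ^ 2 * ‖Q.1 - P.1‖ ^ 2)
        ≤ m := by
    intro P hP Q hQ t h0 h1
    have h := hgm _ (hK.add_smul_sub_mem hP hQ ⟨h0, h1⟩)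
    have e : ‖P.1 + t • (Q.1 - P.1)‖ ^ 2
        = ‖P.1‖ ^ 2 + 2 * t * ⟪P.1, Q.1 - P.1⟫_ℝ + t ^ 2 * ‖Q.1 - P.1‖ ^ 2 := by
      rw [norm_add_sq_real, inner_smul_right, norm_smul, mul_pow, Real.norm_eq_abs, sq_abs]; ring
    simp only [hg, Prod.fst_add, Prod.snd_add, Prod.smul_fst, Prod.smul_snd, Prod.fst_sub,
      Prod.snd_sub, smul_eq_mul, e] at h
    linarith
  -- By the parallelogram law, the midpoint of two near-maximizers exceeds their average value of
  -- `g` by a quarter of the squared distance of their first components; the supremum `m` caps this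
  -- excess.
  have hclose : ∀ n j N : ℕ, N ≤ n → N ≤ j →
      dist (k n).1 (k j).1 ≤ Real.sqrt (4 * (1 / ((N : ℝ) + 1))) := by
    intro n j N hn hj
    apply Real.le_sqrt_of_sq_le
    have h := hcomb (k n) (hkK n) (k j) (hkK j) (1 / 2) (by norm_num) (by norm_num)
    have e : ‖(k j).1‖ ^ 2 = ‖(k n).1‖ ^ 2 + 2 * ⟪(k n).1, (k j).1 - (k n).1⟫_ℝ
        + ‖(k j).1 - (k n).1‖ ^ 2 := by
      rw [← norm_add_sq_real, add_sub_cancel]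
    have h1 := hkg n
    have h2 := hkg j
    have h3 : 1 / ((n : ℝ) + 1) ≤ 1 / ((N : ℝ) + 1) := by gcongr
    have h4 : 1 / ((j : ℝ) + 1) ≤ 1 / ((N : ℝ) + 1) := by gcongr
    simp only [hg] at h1 h2
    rw [dist_comm, dist_eq_norm]
    linarith
  have hlim0 : Tendsto (fun n : ℕ => 1 / ((n : ℝ) + 1)) atTop (𝓝 0) :=
    tendsto_one_div_add_atTop_nhds_zero_nat
  have hcau : CauchySeq fun n => (k n).1 := by
    refine cauchySeq_of_le_tendsto_0 _ hclose ?_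
    have := (hlim0.const_mul 4).sqrt
    simpa using this
  obtain ⟨y, hy⟩ := cauchySeq_tendsto_of_complete hcau
  have hgk : Tendsto (fun n => g (k n)) atTop (𝓝 m) := by
    refine tendsto_of_tendsto_of_tendsto_of_le_of_le (g := fun n : ℕ => m - 1 / ((n : ℝ) + 1))
      (h := fun _ => m) ?_ tendsto_const_nhds (fun n => (hkg n).le) (fun n => hgm _ (hkK n))
    simpa using hlim0.const_sub m
  have hp : Tendsto (fun n => (k n).2) atTop (𝓝 (m + ‖y‖ ^ 2)) := by
    refine (hgk.add (hy.norm.pow 2)).congr fun n => ?_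
    simp [hg]
  refine ⟨y, fun q hq => ?_⟩
  -- First-order optimality at the limiting maximizer, which need not lie in `K`: move from `k n`
  -- towards `q`, let `n → ∞`, then divide by `t`.
  have key : ∀ t : ℝ, 0 < t → t ≤ 1 →
      q.2 - m - ‖y‖ ^ 2 - 2 * ⟪y, q.1 - y⟫_ℝ ≤ t * ‖q.1 - y‖ ^ 2 := by
    intro t h0 h1
    have hl : Tendsto (fun n => (k n).2 + t * (q.2 - (k n).2) - (‖(k n).1‖ ^ 2
        + 2 * t * ⟪(k n).1, q.1 - (k n).1⟫_ℝ + t ^ 2 * ‖q.1 - (k n).1‖ ^ 2)) atTop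
        (𝓝 ((m + ‖y‖ ^ 2) + t * (q.2 - (m + ‖y‖ ^ 2)) - (‖y‖ ^ 2
        + 2 * t * ⟪y, q.1 - y⟫_ℝ + t ^ 2 * ‖q.1 - y‖ ^ 2))) :=
      (hp.add ((hp.const_sub _).const_mul _)).sub (((hy.norm.pow 2).add
        ((hy.inner (hy.const_sub _)).const_mul _)).add (((hy.const_sub _).norm.pow 2).const_mul _))
    have h := le_of_tendsto' hl fun n => hcomb (k n) (hkK n) q hq t h0.le h1
    have : t * (q.2 - m - ‖y‖ ^ 2 - 2 * ⟪y, q.1 - y⟫_ℝ) ≤ t * (t * ‖q.1 - y‖ ^ 2) := by linarith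
    exact le_of_mul_le_mul_left this h0
  have hfin : q.2 - m - ‖y‖ ^ 2 - 2 * ⟪y, q.1 - y⟫_ℝ ≤ 0 := by
    have hl : Tendsto (fun n : ℕ => 1 / ((n : ℝ) + 1) * ‖q.1 - y‖ ^ 2) atTop (𝓝 0) := by
      simpa using hlim0.mul_const (‖q.1 - y‖ ^ 2)
    refine ge_of_tendsto' hl fun n => key _ (by positivity) ?_
    rw [div_le_one (by positivity)]
    linarith [n.cast_nonneg (α := ℝ)]
  rw [inner_sub_right, real_inner_self_eq_norm_sq] at hfin
  linarith

/-- Every monotone set `G ⊆ H × H` is monotonically related to a point of the antidiagonal. -/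
theorem exists_antidiagonal_related [CompleteSpace H] {G : Set (H × H)}
    (hG : ∀ p ∈ G, ∀ q ∈ G, 0 ≤ ⟪p.1 - q.1, p.2 - q.2⟫_ℝ) :
    ∃ y : H, ∀ p ∈ G, 0 ≤ ⟪y - p.1, -y - p.2⟫_ℝ := by
  -- With the second coordinate negated, monotonicity becomes an inequality affine in each of two
  -- points separately. It therefore passes to the convex hull in both, and its diagonal is `h2`.
  set F : Set (H × H × ℝ) := (fun p : H × H => (p.1, -p.2, ⟪p.1, -p.2⟫_ℝ)) '' G with hF
  have haff : ∀ c : H × H × ℝ,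
      Convex ℝ {d : H × H × ℝ | d.2.2 + c.2.2 - ⟪d.1, c.2.1⟫_ℝ - ⟪c.1, d.2.1⟫_ℝ ≤ 0} := by
    intro c d hd e he s t hs ht hst
    simp only [Set.mem_ofPred_eq, Prod.fst_add, Prod.snd_add, Prod.smul_fst, Prod.smul_snd,
      smul_eq_mul, inner_add_left, inner_add_right, real_inner_smul_left,
      real_inner_smul_right] at hd he ⊢
    have h1 := mul_le_mul_of_nonneg_left hd hs
    have h2 := mul_le_mul_of_nonneg_left he ht
    have h3 : c.2.2 = s * c.2.2 + t * c.2.2 := by rw [← add_mul, hst, one_mul]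
    linarith
  have h1 : ∀ c ∈ F, ∀ d ∈ convexHull ℝ F,
      d.2.2 + c.2.2 - ⟪d.1, c.2.1⟫_ℝ - ⟪c.1, d.2.1⟫_ℝ ≤ 0 := by
    intro c hc
    refine fun d hd => convexHull_min (t := {d : H × H × ℝ |
      d.2.2 + c.2.2 - ⟪d.1, c.2.1⟫_ℝ - ⟪c.1, d.2.1⟫_ℝ ≤ 0}) ?_ (haff c) hd
    obtain ⟨p, hp, rfl⟩ := hc
    rintro _ ⟨q, hq, rfl⟩
    have h := hG p hp q hq
    simp only [Set.mem_ofPred_eq, inner_sub_left, inner_sub_right, inner_neg_right] at h ⊢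
    linarith
  have h2 : ∀ d ∈ convexHull ℝ F, d.2.2 ≤ ⟪d.1, d.2.1⟫_ℝ := by
    intro d hd
    have h := convexHull_min (t := {c : H × H × ℝ |
      c.2.2 + d.2.2 - ⟪c.1, d.2.1⟫_ℝ - ⟪d.1, c.2.1⟫_ℝ ≤ 0}) (fun c hc => by
        have := h1 c hc d hd
        simp only [Set.mem_ofPred_eq]; linarith) (haff d) hd
    simp only [Set.mem_ofPred_eq] at h
    linarith
  set f : H × H × ℝ → H × ℝ := fun d => ((1 / 2 : ℝ) • (d.1 + d.2.1), d.2.2) with hf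
  have hlin : IsLinearMap ℝ f := by
    refine ⟨fun a b => ?_, fun c a => ?_⟩
    · ext
      · simp only [hf, Prod.fst_add, Prod.snd_add]; module
      · simp [hf]
    · ext
      · simp only [hf, Prod.smul_fst, Prod.smul_snd]; module
      · simp [hf]
  -- An inner product is at most the squared norm of the midpoint, so the image of the hull lies
  -- below the paraboloid; on points coming from `G` the tangent inequality is the desired relation.
  obtain ⟨y, hy⟩ := exists_tangent_above_of_convex
    ((convex_convexHull ℝ F).is_linear_image hlin) (by
      rintro _ ⟨d, hd, rfl⟩
      have h := h2 d hd
      have e1 := norm_add_sq_real d.1 d.2.1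
      have e2 := norm_sub_sq_real d.1 d.2.1
      have e3 := sq_nonneg ‖d.1 - d.2.1‖
      simp only [hf, norm_smul, mul_pow, Real.norm_eq_abs, sq_abs]
      linarith)
  refine ⟨y, fun p hp => ?_⟩
  have h := hy _ ⟨_, subset_convexHull ℝ F ⟨p, hp, rfl⟩, rfl⟩
  simp only [hf, inner_smul_right, inner_add_right, inner_neg_right] at h
  simp only [inner_sub_left, inner_sub_right, inner_neg_right, real_inner_self_eq_norm_sq]
  rw [real_inner_comm y p.1]
  linarith

/-- A point monotonically related to the graph of a maximal monotone operator belongs to it. -/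
theorem IsMaximalMonotone.mem_of_related {S : H → Set H} (hS : IsMaximalMonotone S) {y v : H}
    (h : ∀ x, ∀ u ∈ S x, 0 ≤ ⟪y - x, v - u⟫_ℝ) : v ∈ S y := by
  by_contra hv
  refine hS.2 (fun x => {u | u ∈ S x ∨ (x = y ∧ u = v)}) ?_ ⟨fun p hp => Or.inl hp, fun hsub =>
    hv (hsub (show (y, v) ∈ gra _ from Or.inr ⟨rfl, rfl⟩))⟩
  rintro a b u (hu | ⟨rfl, rfl⟩) w (hw | ⟨rfl, rfl⟩)
  · exact hS.1 a b u hu w hw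
  · have := h a u hu
    rwa [← neg_sub a, ← neg_sub u, inner_neg_neg] at this
  · exact h b w hw
  · simp

/-- **Minty's theorem**: `I + γS` is surjective for a maximal monotone `S` and `γ > 0`. -/
theorem IsMaximalMonotone.exists_mem_resolventOp [CompleteSpace H] {S : H → Set H} (hS : IsMaximalMonotone S)
    {γ : ℝ} (hγ : 0 < γ) (w : H) : ∃ x, γ⁻¹ • (w - x) ∈ S x := by
  -- This set is the graph of `γS` with values shifted by `-w`, so an antidiagonal point `(y, -y)`
  -- corresponds to `w - y` as a value of `γS` at `y`.
  obtain ⟨y, hy⟩ := exists_antidiagonal_related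
    (G := {p : H × H | γ⁻¹ • (p.2 + w) ∈ S p.1}) (by
      intro p hp q hq
      have h := hS.1 _ _ _ hp _ hq
      rw [← smul_sub, inner_smul_right, add_sub_add_right_eq_sub] at h
      exact nonneg_of_mul_nonneg_right h (inv_pos.2 hγ))
  refine ⟨y, hS.mem_of_related fun x u hu => ?_⟩
  have h := hy (x, γ • u - w) (by
    rwa [Set.mem_ofPred_eq, sub_add_cancel, inv_smul_smul₀ hγ.ne'])
  have e : γ⁻¹ • (w - y) - u = γ⁻¹ • (-y - (γ • u - w)) := by
    rw [smul_sub, smul_sub, smul_sub, smul_smul, inv_mul_cancel₀ hγ.ne', one_smul]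
    module
  rw [e, inner_smul_right]
  exact mul_nonneg (inv_pos.2 hγ).le h

theorem mem_resolventOp_smul {S : H → Set H} {γ : ℝ} (hγ : 0 < γ) {x w : H} :
    x ∈ resolventOp (γ • S) w ↔ γ⁻¹ • (w - x) ∈ S x := by
  simp only [resolventOp, inverseOp, Set.mem_ofPred_eq, Pi.add_apply, Pi.smul_apply, single, id,
    Set.singleton_add, Set.image_add_left, Set.mem_preimage]
  rw [Set.mem_smul_set_iff_inv_smul_mem₀ hγ.ne', neg_add_eq_sub]

theorem IsMaximalMonotone.resolventMap_spec [CompleteSpace H] {S : H → Set H} (hS : IsMaximalMonotone S)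
    {γ : ℝ} (hγ : 0 < γ) (w : H) :
    γ⁻¹ • (w - resolventMap (γ • S) w) ∈ S (resolventMap (γ • S) w) := by
  rw [← mem_resolventOp_smul hγ]
  obtain ⟨x, hx⟩ := hS.exists_mem_resolventOp hγ w
  exact Classical.epsilon_spec (p := fun x => x ∈ resolventOp (γ • S) w)
    ⟨x, (mem_resolventOp_smul hγ).2 hx⟩

end Minty

/-! ### Weak limits along filters -/

section Weak

variable {H : Type*} [NormedAddCommGroup H] [InnerProductSpace ℝ H]

open InnerProductSpace

/-- Weak convergence along a filter, tested against inner products. -/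
def WeakLim {ι : Type*} (l : Filter ι) (u : ι → H) (x : H) : Prop :=
  ∀ y, Tendsto (fun k => ⟪u k, y⟫_ℝ) l (𝓝 ⟪x, y⟫_ℝ)

theorem weaklyTendsto_iff [CompleteSpace H] {u : ℕ → H} {x : H} :
    WeaklyTendsto u x ↔ WeakLim atTop u x := by
  have hinj : Function.Injective (topDualPairing ℝ H).flip := by
    intro a b hab
    refine ext_inner_left ℝ fun v => ?_
    exact DFunLike.congr_fun hab (InnerProductSpace.toDual ℝ H v)
  refine (WeakBilin.tendsto_iff_forall_eval_tendsto _ hinj).trans ⟨fun h y => ?_, fun h f => ?_⟩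
  · have := h (InnerProductSpace.toDual ℝ H y)
    simp only [real_inner_comm y]
    exact this
  · have := h ((InnerProductSpace.toDual ℝ H).symm f)
    simp only [real_inner_comm ((InnerProductSpace.toDual ℝ H).symm f),
      InnerProductSpace.toDual_symm_apply] at this
    exact this

variable {ι : Type*} {l : Filter ι} {u v : ι → H} {x y : H}

theorem WeakLim.add (hu : WeakLim l u x) (hv : WeakLim l v y) :
    WeakLim l (fun k => u k + v k) (x + y) := fun w => by
  simpa only [inner_add_left] using (hu w).add (hv w)

theorem WeakLim.smul (c : ℝ) (hu : WeakLim l u x) : WeakLim l (fun k => c • u k) (c • x) :=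
  fun w => by simpa only [real_inner_smul_left] using (hu w).const_mul c

theorem WeakLim.sub (hu : WeakLim l u x) (hv : WeakLim l v y) :
    WeakLim l (fun k => u k - v k) (x - y) := fun w => by
  simpa only [inner_sub_left] using (hu w).sub (hv w)

theorem WeakLim.mono {l' : Filter ι} (hu : WeakLim l u x) (h : l' ≤ l) : WeakLim l' u x :=
  fun w => (hu w).mono_left h

theorem weakLim_of_tendsto (h : Tendsto u l (𝓝 x)) : WeakLim l u x :=
  fun _ => h.inner tendsto_const_nhds

theorem WeakLim.unique [l.NeBot] (hu : WeakLim l u x) (hv : WeakLim l u y) : x = y :=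
  ext_inner_right ℝ fun w => tendsto_nhds_unique (hu w) (hv w)

/-- Ultrafilters replace subsequences: with Banach–Alaoglu, it is enough to identify each weak
cluster point, and no separability or metrizability enters. -/
theorem weakLim_of_ultrafilter
    (h : ∀ U : Ultrafilter ι, (U : Filter ι) ≤ l → WeakLim U u x) : WeakLim l u x :=
  fun w => (tendsto_iff_ultrafilter _ _ _).2 fun U hU => h U hU w

/-- Bounded families converge weakly along ultrafilters. -/
theorem exists_weakLim_ultrafilter [CompleteSpace H] (U : Ultrafilter ι) {R : ℝ}
    (hR : ∀ k, ‖u k‖ ≤ R) : ∃ x, WeakLim (U : Filter ι) u x := by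
  have hc := WeakDual.isCompact_closedBall (𝕜 := ℝ) (E := H) 0 R
  obtain ⟨f, -, hf⟩ := isCompact_iff_ultrafilter_le_nhds.1 hc
    (U.map fun k => StrongDual.toWeakDual (InnerProductSpace.toDual ℝ H (u k))) (by
      rw [le_principal_iff, Ultrafilter.mem_coe, Ultrafilter.mem_map]
      refine Filter.univ_mem' fun k => ?_
      simp [hR k])
  refine ⟨(InnerProductSpace.toDual ℝ H).symm (WeakDual.toStrongDual f), fun y => ?_⟩
  have h := ((WeakDual.eval_continuous (𝕜 := ℝ) y).tendsto f).comp hf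
  rw [InnerProductSpace.toDual_symm_apply]
  exact h

/-- The pairing of a strongly convergent family with a bounded weakly convergent one. -/
theorem WeakLim.inner_tendsto (hu : WeakLim l u x) {R : ℝ} (hR : ∀ k, ‖u k‖ ≤ R)
    (hv : Tendsto v l (𝓝 y)) : Tendsto (fun k => ⟪u k, v k⟫_ℝ) l (𝓝 ⟪x, y⟫_ℝ) := by
  have h : Tendsto (fun k => ⟪u k, v k - y⟫_ℝ) l (𝓝 0) := by
    refine squeeze_zero_norm (a := fun k => R * ‖v k - y‖) (fun k => ?_) ?_
    · exact (norm_inner_le_norm _ _).trans (by gcongr; exact hR k)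
    · simpa using (tendsto_iff_norm_sub_tendsto_zero.1 hv).const_mul R
  have := (hu y).add h
  simp only [inner_sub_right, add_sub_cancel, add_zero] at this
  exact this

end Weak

/-! ### Telescoping and rates for real sequences -/

section RealSequences

theorem sum_range_le_of_add_le {a b : ℕ → ℝ} (ha : ∀ k, 0 ≤ a k)
    (h : ∀ k, a (k + 1) + b k ≤ a k) (n : ℕ) : ∑ i ∈ Finset.range n, b i ≤ a 0 := by
  have key : ∀ n, ∑ i ∈ Finset.range n, b i + a n ≤ a 0 := by
    intro n
    induction n with
    | zero => simp
    | succ n ih => rw [Finset.sum_range_succ]; linarith [h n]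
  linarith [key n, ha n]

/-- An antitone nonnegative sequence whose weighted sums are bounded tends to zero when the
weights have infinite sum. -/
theorem tendsto_zero_of_antitone_of_sum_le {r τ : ℕ → ℝ} {M : ℝ} (hr : Antitone r)
    (hr0 : ∀ k, 0 ≤ r k) (hτ : ∀ k, 0 ≤ τ k)
    (hsum : Tendsto (fun n => ∑ i ∈ Finset.range n, τ i) atTop atTop)
    (hM : ∀ n, ∑ i ∈ Finset.range n, τ i * r i ≤ M) : Tendsto r atTop (𝓝 0) := by
  have hbdd : BddBelow (Set.range r) := ⟨0, by rintro _ ⟨k, rfl⟩; exact hr0 k⟩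
  have hlim := tendsto_atTop_ciInf hr hbdd
  rcases (le_ciInf hr0).eq_or_lt with h | h
  · rwa [← h] at hlim
  · exfalso
    obtain ⟨n, hn⟩ := (hsum.eventually_gt_atTop (M / ⨅ k, r k)).exists
    rw [div_lt_iff₀ h, Finset.sum_mul] at hn
    refine (hn.trans_le ((Finset.sum_le_sum fun i _ => ?_).trans (hM n))).false
    exact mul_le_mul_of_nonneg_left (ciInf_le hbdd i) (hτ i)

/-- The block of terms from `(n + 1) / 2` to `n` contains at least half of the first `n + 1` indices
and each of its terms is at least `f n`, while its sum is a difference of partial sums with the same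
limit. -/
theorem tendsto_succ_mul_of_antitone_of_summable {f : ℕ → ℝ} (hf : Antitone f)
    (hf0 : ∀ k, 0 ≤ f k) (hs : Summable f) :
    Tendsto (fun n : ℕ => ((n : ℝ) + 1) * f n) atTop (𝓝 0) := by
  have h1 := hs.hasSum.tendsto_sum_nat
  have h2 := h1.comp (tendsto_add_atTop_nat 1)
  have h3 := h1.comp ((Nat.tendsto_div_const_atTop (two_ne_zero)).comp (tendsto_add_atTop_nat 1))
  have h4 := (h2.sub h3).const_mul 2
  rw [sub_self, mul_zero] at h4
  refine squeeze_zero (fun n => mul_nonneg (by positivity) (hf0 n)) (fun n => ?_) h4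
  simp only [Function.comp_apply]
  rw [← Finset.sum_Ico_eq_sub _ (Nat.div_le_self (n + 1) 2)]
  have h5 : ((n + 1 - (n + 1) / 2 : ℕ) : ℝ) * f n ≤
      ∑ i ∈ Finset.Ico ((n + 1) / 2) (n + 1), f i := by
    rw [← Nat.card_Ico, ← nsmul_eq_mul]
    refine Finset.card_nsmul_le_sum _ _ _ fun i hi => hf ?_
    have := (Finset.mem_Ico.1 hi).2
    omega
  have h6 : ((n : ℝ) + 1) ≤ 2 * ((n + 1 - (n + 1) / 2 : ℕ) : ℝ) := by
    have : n + 1 ≤ 2 * (n + 1 - (n + 1) / 2) := by omega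
    exact_mod_cast this
  nlinarith [mul_le_mul_of_nonneg_right h6 (hf0 n)]

end RealSequences

/-! ### Averaged maps, demiclosedness and Opial's lemma -/

section KrasnoselskiiMann

open InnerProductSpace

variable {H : Type*} [NormedAddCommGroup H] [InnerProductSpace ℝ H]

/-- Averaged maps, with constant `1 / (2 - ε)`. -/
def IsAveraged {H : Type*} [NormedAddCommGroup H] (ε : ℝ) (T : H → H) : Prop :=
  ∀ x y, ‖T x - T y‖ ^ 2 + (1 - ε) * ‖(T x - x) - (T y - y)‖ ^ 2 ≤ ‖x - y‖ ^ 2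

variable {ε : ℝ} {T : H → H}

theorem IsAveraged.norm_sub_le {H : Type*} [NormedAddCommGroup H] {T : H → H} (hT : IsAveraged ε T) (hε : ε ≤ 1) (x y : H) :
    ‖T x - T y‖ ≤ ‖x - y‖ := by
  have h := hT x y
  have h1 := mul_nonneg (sub_nonneg.2 hε) (sq_nonneg ‖(T x - x) - (T y - y)‖)
  exact le_of_sq_le_sq (by linarith) (norm_nonneg _)

/-- One relaxed step towards a fixed point. -/
theorem norm_relaxed_step_sq (x t p : H) (c : ℝ) :
    ‖x + c • (t - x) - p‖ ^ 2 =
      (1 - c) * ‖x - p‖ ^ 2 + c * ‖t - p‖ ^ 2 - c * (1 - c) * ‖t - x‖ ^ 2 := by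
  have e : x + c • (t - x) - p = (x - p) + c • (t - x) := by abel
  have e2 : t - p = (x - p) + (t - x) := by abel
  rw [e, e2, norm_add_sq_real, norm_add_sq_real, norm_smul, mul_pow, Real.norm_eq_abs, sq_abs,
    real_inner_smul_right]
  ring

/-- Let `d` be the residual and `e` its change along the step `c • d`. Averagedness gives `2c⟪e, d⟫
+ (2 - ε)‖e‖² ≤ 0`; since `c ≤ 2 - ε`, dividing by `c` gives `‖e + d‖ ≤ ‖d‖`. This also covers
over-relaxation, `c > 1`. -/
theorem IsAveraged.norm_residual_step_le (hT : IsAveraged ε T) {c : ℝ} (h0 : 0 < c)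
    (hc : c ≤ 2 - ε) (x : H) :
    ‖T (x + c • (T x - x)) - (x + c • (T x - x))‖ ≤ ‖T x - x‖ := by
  set d := T x - x with hd
  set x' := x + c • d with hx'
  set e := (T x' - x') - d with he
  have h := hT x' x
  have e1 : T x' - T x = e + c • d := by
    rw [he, hd, hx', hd]; abel
  have e2 : x' - x = c • d := by rw [hx']; abel
  have e3 : T x' - x' = e + d := by rw [he]; abel
  rw [e1, ← hd, ← he, e2, norm_add_sq_real, real_inner_smul_right] at h
  rw [e3]
  refine le_of_sq_le_sq ?_ (norm_nonneg _)
  rw [norm_add_sq_real]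
  have h1 : c * (2 * ⟪e, d⟫_ℝ + ‖e‖ ^ 2) ≤ 0 := by
    nlinarith [mul_nonneg (sub_nonneg.2 hc) (sq_nonneg ‖e‖)]
  nlinarith [nonpos_of_mul_nonpos_right h1 h0]

/-- Demiclosedness of `I - T` at zero for a nonexpansive `T`. -/
theorem isFixedPt_of_weakLim {ι : Type*} {l : Filter ι} [l.NeBot]
    (hT : ∀ x y, ‖T x - T y‖ ≤ ‖x - y‖) {u : ι → H} {p : H} {R : ℝ} (hR : ∀ k, ‖u k‖ ≤ R)
    (hu : WeakLim l u p) (h0 : Tendsto (fun k => ‖T (u k) - u k‖) l (𝓝 0)) :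
    Function.IsFixedPt T p := by
  -- Expanding `‖u k - T p‖²` around `p` and comparing with the nonexpansive bound cancels `‖u k -
  -- p‖²`, which has no known limit.
  have hle : ∀ k, 2 * (⟪u k, p - T p⟫_ℝ - ⟪p, p - T p⟫_ℝ) + ‖p - T p‖ ^ 2 ≤
      ‖T (u k) - u k‖ ^ 2 + 2 * ‖T (u k) - u k‖ * (R + ‖p‖) := by
    intro k
    have e : u k - T p = (u k - p) + (p - T p) := by abel
    have h1 : ‖u k - T p‖ ≤ ‖T (u k) - u k‖ + ‖u k - p‖ := by
      calc ‖u k - T p‖ = ‖(u k - T (u k)) + (T (u k) - T p)‖ := by congr 1; abel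
        _ ≤ _ := (norm_add_le _ _).trans (by rw [norm_sub_rev]; gcongr; exact hT _ _)
    have h2 : ‖u k - p‖ ≤ R + ‖p‖ := (norm_sub_le _ _).trans (by gcongr; exact hR k)
    have h3 := pow_le_pow_left₀ (norm_nonneg _) h1 2
    have h4 := mul_le_mul_of_nonneg_left h2 (norm_nonneg (T (u k) - u k))
    rw [e, norm_add_sq_real, inner_sub_left] at h3
    linarith
  have hl := (((hu (p - T p)).sub_const ⟪p, p - T p⟫_ℝ).const_mul 2).add_const (‖p - T p‖ ^ 2)
  have hr := (h0.pow 2).add ((h0.const_mul 2).mul_const (R + ‖p‖))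
  have h := le_of_tendsto_of_tendsto' hl hr hle
  simp only [sub_self, mul_zero, zero_add, zero_mul, ne_eq, OfNat.ofNat_ne_zero, not_false_eq_true,
    zero_pow, add_zero] at h
  have h5 : ‖p - T p‖ = 0 := by
    have := sq_nonneg ‖p - T p‖
    exact pow_eq_zero_iff (two_ne_zero) |>.1 (le_antisymm h this)
  exact (sub_eq_zero.1 (norm_eq_zero.1 h5)).symm

/-- **Opial's lemma**. -/
theorem exists_weakLim_of_fejer [CompleteSpace H] {u : ℕ → H} {F : Set H} (hF : F.Nonempty)
    (hfej : ∀ p ∈ F, Antitone fun k => ‖u k - p‖)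
    (hclus : ∀ U : Ultrafilter ℕ, (U : Filter ℕ) ≤ atTop →
      ∀ p, WeakLim (U : Filter ℕ) u p → p ∈ F) :
    ∃ p ∈ F, WeakLim atTop u p := by
  obtain ⟨p₀, hp₀⟩ := hF
  have hR : ∀ k, ‖u k‖ ≤ ‖u 0 - p₀‖ + ‖p₀‖ := fun k => by
    have h1 := norm_le_norm_sub_add (u k) p₀
    have h2 : ‖u k - p₀‖ ≤ ‖u 0 - p₀‖ := hfej p₀ hp₀ (Nat.zero_le k)
    linarith
  have hlim : ∀ p ∈ F, ∃ a, Tendsto (fun k => ‖u k - p‖ ^ 2) atTop (𝓝 a) := fun p hp =>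
    ⟨_, (tendsto_atTop_ciInf (hfej p hp)
      ⟨0, by rintro _ ⟨k, rfl⟩; exact norm_nonneg _⟩).pow 2⟩
  set U₀ : Ultrafilter ℕ := Ultrafilter.of atTop with hU₀
  have hU₀le : (U₀ : Filter ℕ) ≤ atTop := Ultrafilter.of_le _
  obtain ⟨p, hp⟩ := exists_weakLim_ultrafilter U₀ hR
  have hpF := hclus U₀ hU₀le p hp
  refine ⟨p, hpF, weakLim_of_ultrafilter fun U hU => ?_⟩
  obtain ⟨q, hq⟩ := exists_weakLim_ultrafilter U hR
  have hqF := hclus U hU q hq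
  obtain ⟨a, ha⟩ := hlim p hpF
  obtain ⟨b, hb⟩ := hlim q hqF
  -- The difference of the two squared distances is affine in `u k`, so the pairing with `q - p`
  -- converges along the whole sequence and takes the same limit along both ultrafilters.
  have hab : Tendsto (fun k => ⟪u k, q - p⟫_ℝ) atTop
      (𝓝 ((a - b - (‖p‖ ^ 2 - ‖q‖ ^ 2)) / 2)) := by
    refine (((ha.sub hb).sub_const (‖p‖ ^ 2 - ‖q‖ ^ 2)).div_const 2).congr fun k => ?_
    rw [norm_sub_sq_real, norm_sub_sq_real, inner_sub_right]
    ring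
  have h1 := tendsto_nhds_unique (hp (q - p)) (hab.mono_left hU₀le)
  have h2 := tendsto_nhds_unique (hq (q - p)) (hab.mono_left hU)
  have h3 : ⟪q - p, q - p⟫_ℝ = 0 := by rw [inner_sub_left, h1, h2, sub_self]
  rw [← sub_eq_zero.1 (inner_self_eq_zero.1 h3)]
  exact hq

end KrasnoselskiiMann

/-! ### The energy inequality and the zeros of the sum -/

section Energy

open InnerProductSpace

variable {H : Type*} [NormedAddCommGroup H] [InnerProductSpace ℝ H]

/-- Here `a`, `b`, `z`, `c` stand for differences of `x_A`, `x_B`, `z` and `C x_B`. Expanding is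
exact up to the cross term `-2γ⟪a, c⟫`. Its part along `b` is handled by cocoercivity; the part
along `a - b` by Young's inequality with weight `ε`, whence the constants `1 - ε` and `2β - γ / ε`.
-/
theorem splitting_energy_aux {β ε γ : ℝ} (hε : 0 < ε) (hγ : 0 < γ) (a b z c : H)
    (hc : β * ‖c‖ ^ 2 ≤ ⟪c, b⟫_ℝ) :
    ‖z - b + a‖ ^ 2 + (1 - ε) * ‖a - b‖ ^ 2 + γ * (2 * β - γ / ε) * ‖c‖ ^ 2 +
      2 * γ * (⟪a, γ⁻¹ • ((2 : ℝ) • b - z - γ • c - a)⟫_ℝ + ⟪b, γ⁻¹ • (z - b)⟫_ℝ) ≤ ‖z‖ ^ 2 := by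
  have hy : 0 ≤ ε * ‖a - b‖ ^ 2 + 2 * γ * ⟪a - b, c⟫_ℝ + γ ^ 2 / ε * ‖c‖ ^ 2 := by
    have h := sq_nonneg ‖ε • (a - b) + γ • c‖
    rw [norm_add_sq_real, norm_smul, norm_smul, mul_pow, mul_pow, Real.norm_eq_abs,
      Real.norm_eq_abs, sq_abs, sq_abs, real_inner_smul_left, real_inner_smul_right] at h
    have := mul_nonneg (inv_pos.2 hε).le h
    calc 0 ≤ _ := this
      _ = _ := by field_simp
  have e : 2 * γ * (⟪a, γ⁻¹ • ((2 : ℝ) • b - z - γ • c - a)⟫_ℝ + ⟪b, γ⁻¹ • (z - b)⟫_ℝ) =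
      2 * (⟪a, (2 : ℝ) • b - z - γ • c - a⟫_ℝ + ⟪b, z - b⟫_ℝ) := by
    rw [real_inner_smul_right, real_inner_smul_right]; field_simp
  have e2 : ‖z - b + a‖ ^ 2 = ‖z‖ ^ 2 + 2 * ⟪z, a - b⟫_ℝ + ‖a - b‖ ^ 2 := by
    rw [← norm_add_sq_real]; congr 2; abel
  have e3 := norm_sub_sq_real a b
  have h2 := mul_le_mul_of_nonneg_left hc hγ.le
  have e4 : γ * (2 * β - γ / ε) = 2 * (γ * β) - γ ^ 2 / ε := by field_simp
  rw [e, e2, e4]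
  simp only [inner_sub_left, inner_sub_right, real_inner_smul_right,
    real_inner_self_eq_norm_sq] at hy h2 ⊢
  rw [real_inner_comm b c] at h2
  rw [real_inner_comm a z, real_inner_comm b z]
  linarith

variable {A B : H → Set H} {C : H → H} {γ : ℝ}

/-- The point of `B (stepB γ B z)` produced by the resolvent. -/
noncomputable def dualB (γ : ℝ) (B : H → Set H) (z : H) : H := γ⁻¹ • (z - stepB γ B z)

/-- The point of `A (stepA γ A B C z)` produced by the resolvent. -/
noncomputable def dualA (γ : ℝ) (A B : H → Set H) (C : H → H) (z : H) : H :=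
  γ⁻¹ • ((2 : ℝ) • stepB γ B z - z - γ • C (stepB γ B z) - stepA γ A B C z)

theorem dualB_mem [CompleteSpace H] (hB : IsMaximalMonotone B) (hγ : 0 < γ) (z : H) :
    dualB γ B z ∈ B (stepB γ B z) := hB.resolventMap_spec hγ z

theorem dualA_mem [CompleteSpace H] (hA : IsMaximalMonotone A) (hγ : 0 < γ) (z : H) :
    dualA γ A B C z ∈ A (stepA γ A B C z) := hA.resolventMap_spec hγ _

theorem splittingMap_sub_self (z : H) :
    splittingMap γ A B C z - z = stepA γ A B C z - stepB γ B z := by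
  rw [splittingMap]; abel

theorem splitting_energy {β ε : ℝ} (hε : 0 < ε) (hγ : 0 < γ) (hC : IsCocoercive β C) (z w : H) :
    ‖splittingMap γ A B C z - splittingMap γ A B C w‖ ^ 2 +
      (1 - ε) * ‖(splittingMap γ A B C z - z) - (splittingMap γ A B C w - w)‖ ^ 2 +
      γ * (2 * β - γ / ε) * ‖C (stepB γ B z) - C (stepB γ B w)‖ ^ 2 +
      2 * γ * (⟪stepA γ A B C z - stepA γ A B C w, dualA γ A B C z - dualA γ A B C w⟫_ℝ +
        ⟪stepB γ B z - stepB γ B w, dualB γ B z - dualB γ B w⟫_ℝ) ≤ ‖z - w‖ ^ 2 := by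
  have h := splitting_energy_aux hε hγ (stepA γ A B C z - stepA γ A B C w)
    (stepB γ B z - stepB γ B w) (z - w) (C (stepB γ B z) - C (stepB γ B w)) (hC _ _)
  have e1 : splittingMap γ A B C z - splittingMap γ A B C w =
      (z - w) - (stepB γ B z - stepB γ B w) + (stepA γ A B C z - stepA γ A B C w) := by
    simp only [splittingMap]; abel
  have e2 : (splittingMap γ A B C z - z) - (splittingMap γ A B C w - w) =
      (stepA γ A B C z - stepA γ A B C w) - (stepB γ B z - stepB γ B w) := by
    simp only [splittingMap]; abel
  have e3 : dualA γ A B C z - dualA γ A B C w = γ⁻¹ • ((2 : ℝ) • (stepB γ B z - stepB γ B w) -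
      (z - w) - γ • (C (stepB γ B z) - C (stepB γ B w)) -
      (stepA γ A B C z - stepA γ A B C w)) := by
    simp only [dualA]; module
  have e4 : dualB γ B z - dualB γ B w = γ⁻¹ • ((z - w) - (stepB γ B z - stepB γ B w)) := by
    simp only [dualB]; module
  rw [e1, e2, e3, e4]
  exact h

theorem inner_dualB_nonneg [CompleteSpace H] (hB : IsMaximalMonotone B) (hγ : 0 < γ) (z w : H) :
    0 ≤ ⟪stepB γ B z - stepB γ B w, dualB γ B z - dualB γ B w⟫_ℝ :=
  hB.1 _ _ _ (dualB_mem hB hγ z) _ (dualB_mem hB hγ w)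

theorem inner_dualA_nonneg [CompleteSpace H] (hA : IsMaximalMonotone A) (hγ : 0 < γ) (z w : H) :
    0 ≤ ⟪stepA γ A B C z - stepA γ A B C w, dualA γ A B C z - dualA γ A B C w⟫_ℝ :=
  hA.1 _ _ _ (dualA_mem hA hγ z) _ (dualA_mem hA hγ w)

theorem norm_stepB_sub_le [CompleteSpace H] (hB : IsMaximalMonotone B) (hγ : 0 < γ) (z w : H) :
    ‖stepB γ B z - stepB γ B w‖ ≤ ‖z - w‖ := by
  have h := inner_dualB_nonneg hB hγ z w
  have e4 : dualB γ B z - dualB γ B w = γ⁻¹ • ((z - w) - (stepB γ B z - stepB γ B w)) := by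
    simp only [dualB]; module
  rw [e4, real_inner_smul_right] at h
  have h1 := nonneg_of_mul_nonneg_right h (inv_pos.2 hγ)
  rw [inner_sub_right, real_inner_self_eq_norm_sq] at h1
  have h2 := real_inner_le_norm (stepB γ B z - stepB γ B w) (z - w)
  by_contra! hlt
  nlinarith [norm_nonneg (z - w)]

theorem isAveraged_splittingMap [CompleteSpace H] {β ε : ℝ} (hA : IsMaximalMonotone A)
    (hB : IsMaximalMonotone B) (hε : 0 < ε) (hγ : 0 < γ) (hγβ : 0 ≤ γ * (2 * β - γ / ε))
    (hC : IsCocoercive β C) : IsAveraged ε (splittingMap γ A B C) := by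
  intro z w
  have h := splitting_energy (A := A) (B := B) hε hγ hC z w
  have h1 := inner_dualA_nonneg (B := B) (C := C) hA hγ z w
  have h2 := inner_dualB_nonneg hB hγ z w
  have h3 := mul_nonneg hγβ (sq_nonneg ‖C (stepB γ B z) - C (stepB γ B w)‖)
  have h4 := mul_nonneg (mul_nonneg zero_le_two hγ.le) (add_nonneg h1 h2)
  linarith

theorem stepA_eq_stepB_of_isFixedPt {p : H} (hp : Function.IsFixedPt (splittingMap γ A B C) p) :
    stepA γ A B C p = stepB γ B p := by
  rw [← sub_eq_zero, ← splittingMap_sub_self, hp.eq, sub_self]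

/-- At a fixed point `x_A` and `x_B` coincide, and the two resolvent values `dualA` and `dualB` sum
to `-C x_B`. -/
theorem stepB_mem_zer [CompleteSpace H] (hA : IsMaximalMonotone A) (hB : IsMaximalMonotone B)
    (hγ : 0 < γ) {p : H} (hp : Function.IsFixedPt (splittingMap γ A B C) p) :
    stepB γ B p ∈ zer (A + B + single C) := by
  have hab := stepA_eq_stepB_of_isFixedPt hp
  have h1 := dualA_mem (B := B) (C := C) hA hγ p
  rw [hab] at h1
  refine ⟨_, ⟨_, h1, _, dualB_mem hB hγ p, rfl⟩, _, rfl, ?_⟩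
  simp only [dualA, dualB, hab, ← smul_add]
  rw [show (2 : ℝ) • stepB γ B p - p - γ • C (stepB γ B p) - stepB γ B p + (p - stepB γ B p) =
    γ • (-C (stepB γ B p)) by module, inv_smul_smul₀ hγ.ne', neg_add_cancel]

/-- A cocoercive map is constant on the zeros of its sum with monotone operators. -/
theorem eq_of_mem_zer {β : ℝ} (hA : IsMonotoneOp A) (hB : IsMonotoneOp B) (hβ : 0 < β)
    (hC : IsCocoercive β C) {x y : H} (hx : x ∈ zer (A + B + single C))
    (hy : y ∈ zer (A + B + single C)) : C x = C y := by
  obtain ⟨_, ⟨a, ha, b, hb, rfl⟩, _, rfl, h1⟩ := hx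
  obtain ⟨_, ⟨a', ha', b', hb', rfl⟩, _, rfl, h2⟩ := hy
  have h3 := hA x y a ha a' ha'
  have h4 := hB x y b hb b' hb'
  have h5 := hC x y
  have e : C x - C y = -((a - a') + (b - b')) := by
    simp only at h1 h2
    rw [eq_neg_of_add_eq_zero_right h1, eq_neg_of_add_eq_zero_right h2]; abel
  have h6 : ⟪C x - C y, x - y⟫_ℝ ≤ 0 := by
    rw [real_inner_comm, e, inner_neg_right, inner_add_right]; linarith
  have h7 : ‖C x - C y‖ ^ 2 ≤ 0 := nonpos_of_mul_nonpos_right (h5.trans h6) hβ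
  exact sub_eq_zero.1 (norm_eq_zero.1 (pow_eq_zero_iff two_ne_zero |>.1
    (le_antisymm h7 (sq_nonneg _))))

end Energy

/-! ### Strong convergence from uniform monotonicity -/

section StrongConvergence

open InnerProductSpace

variable {H : Type*} [NormedAddCommGroup H] [InnerProductSpace ℝ H]

theorem UniformlyMonotoneOnBounded.tendsto {S : H → Set H} (hS : UniformlyMonotoneOnBounded S)
    {xs us : ℕ → H} {x u : H} (hxs : ∀ k, us k ∈ S (xs k)) (hx : u ∈ S x) {R : ℝ}
    (hR : ∀ k, ‖xs k‖ ≤ R)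
    (h : Tendsto (fun k => ⟪xs k - x, us k - u⟫_ℝ) atTop (𝓝 0)) :
    Tendsto xs atTop (𝓝 x) := by
  obtain ⟨φ, hmono, hzero, hφ⟩ := hS (insert x (Set.range xs)) ⟨x, Set.mem_insert _ _⟩
    (((isBounded_iff_forall_norm_le.2 ⟨R, by rintro _ ⟨k, rfl⟩; exact hR k⟩)).insert x) (by
      rintro _ (rfl | ⟨k, rfl⟩)
      · exact ⟨u, hx⟩
      · exact ⟨us k, hxs k⟩)
  rw [tendsto_iff_norm_sub_tendsto_zero, Metric.tendsto_atTop']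
  intro δ hδ
  lift δ to ℝ≥0 using hδ.le
  have hpos : 0 < φ δ := pos_iff_ne_zero.2 fun h0 =>
    hδ.ne' (congrArg NNReal.toReal ((hzero _).1 h0))
  -- `φ δ` may be infinite, so a finite positive threshold below it is used.
  obtain ⟨r, hr0, hr⟩ := ENNReal.lt_iff_exists_nnreal_btwn.1 hpos
  have hr0' : (0 : ℝ) < r := by exact_mod_cast hr0
  obtain ⟨N, hN⟩ := eventually_atTop.1 (h.eventually_lt_const hr0')
  refine ⟨N, fun k hk => ?_⟩
  by_contra! hle
  have hle' : δ ≤ ‖xs k - x‖₊ := by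
    rw [← NNReal.coe_le_coe]
    simpa using hle
  have h1 := hφ (xs k) (Set.mem_insert_of_mem _ ⟨k, rfl⟩) x (Set.mem_insert _ _) _ (hxs k) u hx
  have h2 : ((r : ℝ≥0∞) : EReal) ≤ ((⟪xs k - x, us k - u⟫_ℝ : ℝ) : EReal) :=
    (EReal.coe_ennreal_le_coe_ennreal_iff.2 (hr.le.trans (hmono hle'))).trans h1
  have h3 : (r : ℝ) ≤ ⟪xs k - x, us k - u⟫_ℝ := by
    rw [EReal.coe_nnreal_eq_coe_real, EReal.coe_le_coe_iff] at h2
    simpa using h2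
  exact absurd (hN k hk.le) (not_lt.2 h3)

end StrongConvergence

/-! ### Weak convergence of the resolvent sequence -/

section Limits

open InnerProductSpace

variable {H : Type*} [NormedAddCommGroup H] [InnerProductSpace ℝ H] [CompleteSpace H]
  {A B : H → Set H} {C : H → H} {γ : ℝ}

/-- Along an ultrafilter, let `x` and `y'` be the weak limits of `x_B` and `dualB`. The differences
`x_A - x_B` and sums `dualA + dualB` converge strongly, so adding the monotonicity inequalities of
`A` and `B` leaves only weak-strong pairings. -/
theorem weakLim_stepB (hA : IsMaximalMonotone A) (hB : IsMaximalMonotone B) (hγ : 0 < γ)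
    {z : ℕ → H} {p q : H} {R : ℝ} (hR : ∀ k, ‖z k‖ ≤ R) (hz : WeakLim atTop z p)
    (h0 : Tendsto (fun k => splittingMap γ A B C (z k) - z k) atTop (𝓝 0))
    (hC : Tendsto (fun k => C (stepB γ B (z k))) atTop (𝓝 q)) :
    WeakLim atTop (fun k => stepB γ B (z k)) (stepB γ B p) := by
  have hR' : ∀ k, ‖stepB γ B (z k)‖ ≤ R + ‖stepB γ B 0‖ := fun k => by
    have h1 := norm_stepB_sub_le hB hγ (z k) 0
    rw [sub_zero] at h1
    have h2 := norm_le_norm_sub_add (stepB γ B (z k)) (stepB γ B 0)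
    linarith [hR k]
  refine weakLim_of_ultrafilter fun U hU => ?_
  obtain ⟨x, hx⟩ := exists_weakLim_ultrafilter U hR'
  suffices hxp : x = stepB γ B p by rwa [← hxp]
  set d : ℕ → H := fun k => splittingMap γ A B C (z k) - z k with hd
  set e : ℕ → H := fun k => C (stepB γ B (z k)) + γ⁻¹ • d k with he
  have hdU : Tendsto d U (𝓝 0) := h0.mono_left hU
  have heU : Tendsto e U (𝓝 q) := by
    simpa using (hC.mono_left hU).add (hdU.const_smul γ⁻¹)
  have huB : WeakLim (U : Filter ℕ) (fun k => dualB γ B (z k)) (γ⁻¹ • (p - x)) :=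
    ((hz.mono hU).sub hx).smul _
  have hRB : ∀ k, ‖dualB γ B (z k)‖ ≤ γ⁻¹ * (R + (R + ‖stepB γ B 0‖)) := fun k => by
    rw [dualB, norm_smul, Real.norm_of_nonneg (inv_pos.2 hγ).le]
    have := norm_sub_le (z k) (stepB γ B (z k))
    have := hR k
    have := hR' k
    gcongr
    linarith
  have hxA : ∀ k, stepA γ A B C (z k) = stepB γ B (z k) + d k := fun k => by
    rw [hd]; simp only [splittingMap_sub_self]; abel
  have huA : ∀ k, dualA γ A B C (z k) = -dualB γ B (z k) - e k := fun k => by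
    simp only [dualA, dualB, he, hxA]
    rw [← inv_smul_smul₀ hγ.ne' (C (stepB γ B (z k)))]
    simp only [smul_inv_smul₀ hγ.ne']
    module
  set y' : H := γ⁻¹ • (p - x) with hy'
  set y : H := -y' - q with hy
  -- These test points turn the limiting inequality into `-γ⁻¹(‖x - a‖² + ‖x - b‖²) ≥ 0`. Hence `x =
  -- b`, the resolvent of `B` at `x + γ • y' = p`.
  set a := resolventMap (γ • A) (x + γ • y) with ha
  set b := resolventMap (γ • B) (x + γ • y') with hb
  have hav : γ⁻¹ • (x + γ • y - a) ∈ A a := hA.resolventMap_spec hγ _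
  have hbw : γ⁻¹ • (x + γ • y' - b) ∈ B b := hB.resolventMap_spec hγ _
  set v := γ⁻¹ • (x + γ • y - a) with hv
  set w := γ⁻¹ • (x + γ • y' - b) with hw
  have hnn : ∀ k, 0 ≤ ⟪stepB γ B (z k), -e k - v - w⟫_ℝ + ⟪d k - a, -e k - v⟫_ℝ
      - ⟪dualB γ B (z k), d k - a + b⟫_ℝ + ⟪b, w⟫_ℝ := by
    intro k
    have h1 := hA.1 _ _ _ (dualA_mem (B := B) (C := C) hA hγ (z k)) _ hav
    have h2 := hB.1 _ _ _ (dualB_mem hB hγ (z k)) _ hbw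
    rw [hxA, huA] at h1
    refine (add_nonneg h1 h2).trans_eq ?_
    simp only [inner_add_left, inner_sub_left, inner_add_right, inner_sub_right, inner_neg_right]
    rw [real_inner_comm (dualB γ B (z k)) (d k), real_inner_comm (dualB γ B (z k)) a,
      real_inner_comm (dualB γ B (z k)) b]
    ring
  have hl := (((hx.inner_tendsto hR' ((heU.neg.sub_const v).sub_const w)).add
    ((hdU.sub_const a).inner (heU.neg.sub_const v))).sub
    (huB.inner_tendsto hRB ((hdU.sub_const a).add_const b))).add_const ⟪b, w⟫_ℝ
  have hlim := ge_of_tendsto' hl hnn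
  have ev : y - v = -(γ⁻¹ • (x - a)) := by
    rw [hv, show x + γ • y - a = (x - a) + γ • y by abel, smul_add, inv_smul_smul₀ hγ.ne']; abel
  have ew : y' - w = -(γ⁻¹ • (x - b)) := by
    rw [hw, show x + γ • y' - b = (x - b) + γ • y' by abel, smul_add, inv_smul_smul₀ hγ.ne']; abel
  have hq : -q = y + y' := by rw [hy]; abel
  have hsum : 0 ≤ ⟪x - a, y - v⟫_ℝ + ⟪x - b, y' - w⟫_ℝ := by
    refine hlim.trans_eq ?_
    rw [hq]
    simp only [inner_sub_left, inner_add_right, inner_sub_right, zero_sub,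
      inner_neg_left, inner_neg_right]
    rw [real_inner_comm y' a, real_inner_comm y' b]
    ring
  rw [ev, ew, inner_neg_right, inner_neg_right, real_inner_smul_right, real_inner_smul_right,
    real_inner_self_eq_norm_sq, real_inner_self_eq_norm_sq] at hsum
  have h1 := mul_nonneg (inv_pos.2 hγ).le (sq_nonneg ‖x - a‖)
  have h2 : γ⁻¹ * ‖x - b‖ ^ 2 ≤ 0 := by linarith
  have h3 := nonpos_of_mul_nonpos_right h2 (inv_pos.2 hγ)
  have hxb : x = b := sub_eq_zero.1 (norm_eq_zero.1 (pow_eq_zero_iff two_ne_zero |>.1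
    (le_antisymm h3 (sq_nonneg _))))
  rw [hxb, hb, hy', smul_inv_smul₀ hγ.ne', add_sub_cancel, stepB]

end Limits

end MonotoneSplitting

/-! ### The convergence theorem -/

open InnerProductSpace

theorem mainTheorem1
    {H : Type*} [NormedAddCommGroup H] [InnerProductSpace ℝ H] [CompleteSpace H]
    (A B : H → Set H) (C : H → H)
    (hA : IsMaximalMonotone A) (hB : IsMaximalMonotone B)
    (β : ℝ) (hβ : 0 < β) (hC : IsCocoercive β C)
    (ε : ℝ) (hε : ε ∈ Set.Ioo (0 : ℝ) 1)
    (γ : ℝ) (hγ : γ ∈ Set.Ioo (0 : ℝ) (2 * β * ε))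
    (hFix : (Function.fixedPoints (splittingMap γ A B C)).Nonempty)
    (α : ℝ) (hα : α = 1 / (2 - ε))
    (lam : ℕ → ℝ) (hlam : ∀ k, lam k ∈ Set.Ioo (0 : ℝ) (1 / α))
    (τ : ℕ → ℝ) (hτ : ∀ k, τ k = (1 - α * lam k) * lam k / α)
    (hsum : Tendsto (fun n => ∑ i ∈ Finset.range n, τ i) atTop atTop)
    (z : ℕ → H)
    (hz : ∀ k, z (k + 1) = z k + lam k • (splittingMap γ A B C (z k) - z k)) :
    -- (1) Fejér monotonicity
    (∀ zs ∈ Function.fixedPoints (splittingMap γ A B C), Antitone (fun j => ‖z j - zs‖)) ∧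
    -- (2) the residual decreases to zero
    (Antitone (fun j => ‖splittingMap γ A B C (z j) - z j‖) ∧
      Tendsto (fun j => ‖splittingMap γ A B C (z j) - z j‖) atTop (𝓝 0)) ∧
    -- (3) weak convergence to a fixed point
    (∃ zs ∈ Function.fixedPoints (splittingMap γ A B C), WeaklyTendsto z zs) ∧
    -- (4) summability for the cocoercive operator
    (0 < ⨅ j, lam j → ∀ xs ∈ zer (A + B + single C),
      (∀ zs ∈ Function.fixedPoints (splittingMap γ A B C),
        Summable (fun k => lam k * ‖C (stepB γ B (z k)) - C xs‖ ^ 2) ∧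
        ∑' k, lam k * ‖C (stepB γ B (z k)) - C xs‖ ^ 2 ≤
          1 / (γ * (2 * β - γ / ε)) * ‖z 0 - zs‖ ^ 2) ∧
      Tendsto (fun k => C (stepB γ B (z k))) atTop (𝓝 (C xs))) ∧
    -- (5) weak convergence of `x_B`
    (0 < ⨅ j, lam j → ∀ zs, WeaklyTendsto z zs →
      stepB γ B zs ∈ zer (A + B + single C) ∧
      WeaklyTendsto (fun k => stepB γ B (z k)) (stepB γ B zs)) ∧
    -- (6) weak convergence of `x_A`
    (0 < ⨅ j, lam j → ∀ zs, WeaklyTendsto z zs →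
      stepB γ B zs ∈ zer (A + B + single C) ∧
      WeaklyTendsto (fun k => stepA γ A B C (z k)) (stepB γ B zs)) ∧
    -- (7) rates for the residual
    (0 < ⨅ j, τ j →
      (∀ zs ∈ Function.fixedPoints (splittingMap γ A B C), ∀ k : ℕ,
        ‖splittingMap γ A B C (z k) - z k‖ ^ 2 ≤
          ‖z 0 - zs‖ ^ 2 / ((⨅ j, τ j) * ((k : ℝ) + 1))) ∧
      (fun k : ℕ => ‖splittingMap γ A B C (z k) - z k‖ ^ 2) =o[atTop]
        (fun k : ℕ => 1 / ((k : ℝ) + 1))) ∧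
    -- (8) strong convergence
    (∀ zs, WeaklyTendsto z zs →
      (UniformlyMonotoneOnBounded A ∨ UniformlyMonotoneOnBounded B ∨
        (∀ x ∈ zer (A + B + single C), DemiregularAt (single C) x)) →
      stepB γ B zs ∈ zer (A + B + single C) ∧
      Tendsto (fun k => stepB γ B (z k)) atTop (𝓝 (stepB γ B zs)) ∧
      Tendsto (fun k => stepA γ A B C (z k)) atTop (𝓝 (stepB γ B zs))) := by
  obtain ⟨hε0, hε1⟩ := hε
  obtain ⟨hγ0, hγ1⟩ := hγ
  have hκ : 0 < γ * (2 * β - γ / ε) :=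
    mul_pos hγ0 (sub_pos.2 ((div_lt_iff₀ hε0).2 hγ1))
  have hαinv : 1 / α = 2 - ε := by rw [hα, one_div_one_div]
  have hα0 : α ≠ 0 := by
    rw [hα]; exact one_div_ne_zero (by linarith)
  have hlam0 : ∀ k, 0 < lam k := fun k => (hlam k).1
  have hlam1 : ∀ k, lam k < 2 - ε := fun k => hαinv ▸ (hlam k).2
  have hτ' : ∀ k, τ k = lam k * (2 - ε - lam k) := fun k => by
    rw [hτ, ← hαinv]; field_simp
  have hτ0 : ∀ k, 0 ≤ τ k := fun k => by
    rw [hτ']; exact mul_nonneg (hlam0 k).le (sub_nonneg.2 (hlam1 k).le)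
  set T := splittingMap γ A B C with hTdef
  have hav : IsAveraged ε T := isAveraged_splittingMap hA hB hε0 hγ0 hκ.le hC
  have henergy : ∀ p ∈ Function.fixedPoints T, ∀ k, ‖T (z k) - p‖ ^ 2 +
      (1 - ε) * ‖T (z k) - z k‖ ^ 2 + γ * (2 * β - γ / ε) *
        ‖C (stepB γ B (z k)) - C (stepB γ B p)‖ ^ 2 +
      2 * γ * (⟪stepA γ A B C (z k) - stepA γ A B C p,
          dualA γ A B C (z k) - dualA γ A B C p⟫_ℝ +
        ⟪stepB γ B (z k) - stepB γ B p, dualB γ B (z k) - dualB γ B p⟫_ℝ) ≤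
      ‖z k - p‖ ^ 2 := fun p hp k => by
    have h := splitting_energy (A := A) (B := B) hε0 hγ0 hC (z k) p
    have hp' : T p = p := hp
    rwa [← hTdef, hp', sub_self, sub_zero] at h
  have hnnA := fun k p => inner_dualA_nonneg (B := B) (C := C) hA hγ0 (z k) p
  have hnnB := fun k p => inner_dualB_nonneg hB hγ0 (z k) p
  -- The relaxation identity contributes `lam k * (1 - lam k)` and averagedness `lam k * (1 - ε)`;
  -- their sum is exactly `τ k`.
  have hdescent : ∀ p ∈ Function.fixedPoints T, ∀ k, ‖z (k + 1) - p‖ ^ 2 +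
      (τ k * ‖T (z k) - z k‖ ^ 2 + γ * (2 * β - γ / ε) *
        (lam k * ‖C (stepB γ B (z k)) - C (stepB γ B p)‖ ^ 2)) ≤ ‖z k - p‖ ^ 2 := by
    intro p hp k
    have h := henergy p hp k
    have h1 := mul_nonneg (mul_nonneg zero_le_two hγ0.le) (add_nonneg (hnnA k p) (hnnB k p))
    have h2 := mul_le_mul_of_nonneg_left (le_of_add_le_of_nonneg_left h h1) (hlam0 k).le
    rw [hz, norm_relaxed_step_sq, hτ']
    linarith
  have hκc : ∀ p k, 0 ≤ γ * (2 * β - γ / ε) *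
      (lam k * ‖C (stepB γ B (z k)) - C (stepB γ B p)‖ ^ 2) := fun p k =>
    mul_nonneg hκ.le (mul_nonneg (hlam0 k).le (sq_nonneg _))
  have hτr : ∀ k, 0 ≤ τ k * ‖T (z k) - z k‖ ^ 2 := fun k => mul_nonneg (hτ0 k) (sq_nonneg _)
  have hfejer : ∀ p ∈ Function.fixedPoints T, Antitone (fun j => ‖z j - p‖) := fun p hp =>
    antitone_nat_of_succ_le fun k => le_of_sq_le_sq
      (by linarith [hdescent p hp k, hκc p k, hτr k]) (norm_nonneg _)
  have hsumr : ∀ p ∈ Function.fixedPoints T, ∀ n,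
      ∑ i ∈ Finset.range n, τ i * ‖T (z i) - z i‖ ^ 2 ≤ ‖z 0 - p‖ ^ 2 := fun p hp =>
    sum_range_le_of_add_le (a := fun k => ‖z k - p‖ ^ 2) (fun k => sq_nonneg _)
      (fun k => by linarith [hdescent p hp k, hκc p k])
  have hanti : Antitone (fun j => ‖T (z j) - z j‖) := antitone_nat_of_succ_le fun k => by
    rw [hz]; exact hav.norm_residual_step_le (hlam0 k) (hlam1 k).le (z k)
  have hanti2 : Antitone (fun j => ‖T (z j) - z j‖ ^ 2) := fun i j hij =>
    pow_le_pow_left₀ (norm_nonneg _) (hanti hij) 2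
  obtain ⟨p₀, hp₀⟩ := hFix
  have hres : Tendsto (fun j => ‖T (z j) - z j‖) atTop (𝓝 0) := by
    have h := (tendsto_zero_of_antitone_of_sum_le hanti2 (fun k => sq_nonneg _) hτ0 hsum
      (hsumr p₀ hp₀)).sqrt
    simpa using h
  have hres' : Tendsto (fun j => T (z j) - z j) atTop (𝓝 0) :=
    tendsto_zero_iff_norm_tendsto_zero.2 hres
  have hR : ∀ k, ‖z k‖ ≤ ‖z 0 - p₀‖ + ‖p₀‖ := fun k => by
    have h1 := norm_le_norm_sub_add (z k) p₀
    have h2 : ‖z k - p₀‖ ≤ ‖z 0 - p₀‖ := hfejer p₀ hp₀ (Nat.zero_le k)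
    linarith
  have hweak : ∃ p ∈ Function.fixedPoints T, WeakLim atTop z p :=
    exists_weakLim_of_fejer ⟨p₀, hp₀⟩ hfejer fun U hU p hp =>
      isFixedPt_of_weakLim (hav.norm_sub_le hε1.le) hR hp (hres.mono_left hU)
  have hgap : ∀ p ∈ Function.fixedPoints T,
      Tendsto (fun k => 2 * ‖z 0 - p‖ * ‖T (z k) - z k‖) atTop (𝓝 0) := fun p _ => by
    simpa using hres.const_mul (2 * ‖z 0 - p‖)
  -- Factor the gap as a difference of squares: one factor is at most the residual, the other at
  -- most `2 * ‖z 0 - p‖` by Fejér monotonicity.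
  have hgap_le : ∀ p ∈ Function.fixedPoints T, ∀ k, γ * (2 * β - γ / ε) *
        ‖C (stepB γ B (z k)) - C (stepB γ B p)‖ ^ 2 +
      2 * γ * (⟪stepA γ A B C (z k) - stepA γ A B C p,
          dualA γ A B C (z k) - dualA γ A B C p⟫_ℝ +
        ⟪stepB γ B (z k) - stepB γ B p, dualB γ B (z k) - dualB γ B p⟫_ℝ) ≤
      2 * ‖z 0 - p‖ * ‖T (z k) - z k‖ := by
    intro p hp k
    have h := henergy p hp k
    have h0 := mul_nonneg (sub_nonneg.2 hε1.le) (sq_nonneg ‖T (z k) - z k‖)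
    have h1 : ‖z k - p‖ ≤ ‖z 0 - p‖ := hfejer p hp (Nat.zero_le k)
    have h2 : ‖z k - p‖ - ‖T (z k) - p‖ ≤ ‖T (z k) - z k‖ := by
      refine (norm_sub_norm_le _ _).trans_eq ?_
      rw [norm_sub_rev (T (z k))]; congr 1; abel
    have h3 : ‖T (z k) - p‖ ≤ ‖z k - p‖ := by
      have hp' : T p = p := hp
      have := hav.norm_sub_le hε1.le (z k) p
      rwa [hp'] at this
    have h4 := norm_nonneg (T (z k) - p)
    nlinarith [norm_nonneg (T (z k) - z k), mul_nonneg (sub_nonneg.2 h2)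
      (add_nonneg (norm_nonneg (z k - p)) h4)]
  have hCp : ∀ p ∈ Function.fixedPoints T,
      Tendsto (fun k => C (stepB γ B (z k))) atTop (𝓝 (C (stepB γ B p))) := by
    intro p hp
    rw [tendsto_iff_norm_sub_tendsto_zero]
    have h : Tendsto (fun k => ‖C (stepB γ B (z k)) - C (stepB γ B p)‖ ^ 2) atTop (𝓝 0) := by
      have h0 := (hgap p hp).const_mul (γ * (2 * β - γ / ε))⁻¹
      rw [mul_zero] at h0
      refine squeeze_zero (fun _ => sq_nonneg _) (fun k => ?_) h0
      rw [← div_eq_inv_mul, le_div_iff₀ hκ, mul_comm]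
      have := mul_nonneg (mul_nonneg zero_le_two hγ0.le) (add_nonneg (hnnA k p) (hnnB k p))
      linarith [hgap_le p hp k]
    simpa using h.sqrt
  have hiA : ∀ p ∈ Function.fixedPoints T, Tendsto (fun k => ⟪stepA γ A B C (z k) -
      stepA γ A B C p, dualA γ A B C (z k) - dualA γ A B C p⟫_ℝ) atTop (𝓝 0) := by
    intro p hp
    have h0 := (hgap p hp).const_mul (2 * γ)⁻¹
    rw [mul_zero] at h0
    refine squeeze_zero (fun k => hnnA k p) (fun k => ?_) h0
    rw [← div_eq_inv_mul, le_div_iff₀ (by positivity), mul_comm]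
    have h1 := mul_nonneg (mul_nonneg zero_le_two hγ0.le) (hnnB k p)
    have h2 := mul_nonneg hκ.le (sq_nonneg ‖C (stepB γ B (z k)) - C (stepB γ B p)‖)
    linarith [hgap_le p hp k]
  have hiB : ∀ p ∈ Function.fixedPoints T, Tendsto (fun k => ⟪stepB γ B (z k) -
      stepB γ B p, dualB γ B (z k) - dualB γ B p⟫_ℝ) atTop (𝓝 0) := by
    intro p hp
    have h0 := (hgap p hp).const_mul (2 * γ)⁻¹
    rw [mul_zero] at h0
    refine squeeze_zero (fun k => hnnB k p) (fun k => ?_) h0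
    rw [← div_eq_inv_mul, le_div_iff₀ (by positivity), mul_comm]
    have h1 := mul_nonneg (mul_nonneg zero_le_two hγ0.le) (hnnA k p)
    have h2 := mul_nonneg hκ.le (sq_nonneg ‖C (stepB γ B (z k)) - C (stepB γ B p)‖)
    linarith [hgap_le p hp k]
  have hfix : ∀ p, WeaklyTendsto z p → p ∈ Function.fixedPoints T := fun p hp => by
    obtain ⟨q, hq, hzq⟩ := hweak
    rwa [(weaklyTendsto_iff.1 hp).unique hzq]
  have hzer : ∀ p ∈ Function.fixedPoints T, stepB γ B p ∈ zer (A + B + single C) :=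
    fun p hp => stepB_mem_zer hA hB hγ0 hp
  have hxA : ∀ k, stepB γ B (z k) + (T (z k) - z k) = stepA γ A B C (z k) := fun k => by
    rw [hTdef, splittingMap_sub_self, add_sub_cancel]
  have hwB : ∀ p, WeaklyTendsto z p → WeakLim atTop (fun k => stepB γ B (z k)) (stepB γ B p) :=
    fun p hp => weakLim_stepB hA hB hγ0 hR (weaklyTendsto_iff.1 hp) hres' (hCp p (hfix p hp))
  refine ⟨hfejer, ⟨hanti, hres⟩, ?_, fun _ xs hxs => ⟨fun p hp => ?_, ?_⟩, fun _ p hp =>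
    ⟨hzer p (hfix p hp), weaklyTendsto_iff.2 (hwB p hp)⟩, fun _ p hp =>
    ⟨hzer p (hfix p hp), weaklyTendsto_iff.2 ?_⟩, fun hτpos => ⟨fun p hp k => ?_, ?_⟩,
    fun p hp hcase => ⟨hzer p (hfix p hp), ?_⟩⟩
  · obtain ⟨p, hp, hzp⟩ := hweak
    exact ⟨p, hp, weaklyTendsto_iff.2 hzp⟩
  -- `C` takes a single value on the zeros, so `xs` may be replaced by the zero attached to `p`.
  · rw [eq_of_mem_zer hA.1 hB.1 hβ hC hxs (hzer p hp)]
    have hnn : ∀ k, 0 ≤ lam k * ‖C (stepB γ B (z k)) - C (stepB γ B p)‖ ^ 2 := fun k =>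
      mul_nonneg (hlam0 k).le (sq_nonneg _)
    have hle : ∀ n, ∑ k ∈ Finset.range n, lam k * ‖C (stepB γ B (z k)) - C (stepB γ B p)‖ ^ 2 ≤
        1 / (γ * (2 * β - γ / ε)) * ‖z 0 - p‖ ^ 2 := fun n => by
      rw [one_div_mul_eq_div, le_div_iff₀ hκ, mul_comm, Finset.mul_sum]
      exact sum_range_le_of_add_le (a := fun k => ‖z k - p‖ ^ 2) (fun k => sq_nonneg _)
        (fun k => by linarith [hdescent p hp k, hτr k]) n
    exact ⟨summable_of_sum_range_le hnn hle, Real.tsum_le_of_sum_range_le hnn hle⟩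
  · rw [eq_of_mem_zer hA.1 hB.1 hβ hC hxs (hzer p₀ hp₀)]
    exact hCp p₀ hp₀
  · have h := (hwB p hp).add (weakLim_of_tendsto hres')
    simpa only [hxA, add_zero] using h
  · have hbdd : BddBelow (Set.range τ) := ⟨0, by rintro _ ⟨k, rfl⟩; exact hτ0 k⟩
    rw [le_div_iff₀ (by positivity)]
    refine le_trans ?_ (hsumr p hp (k + 1))
    -- The residual at `k` is the smallest of the first `k + 1`, so each of these terms is at least
    -- `⨅ τ` times its square.
    have h := Finset.card_nsmul_le_sum (Finset.range (k + 1))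
      (fun i => τ i * ‖T (z i) - z i‖ ^ 2) ((⨅ j, τ j) * ‖T (z k) - z k‖ ^ 2) fun i hi =>
        mul_le_mul (ciInf_le hbdd i) (hanti2 (Finset.mem_range_succ_iff.1 hi)) (sq_nonneg _)
          (hτ0 i)
    rw [Finset.card_range, nsmul_eq_mul, Nat.cast_succ] at h
    linarith
  · have hbdd : BddBelow (Set.range τ) := ⟨0, by rintro _ ⟨k, rfl⟩; exact hτ0 k⟩
    have hs : Summable fun k => ‖T (z k) - z k‖ ^ 2 := by
      refine summable_of_sum_range_le (c := ‖z 0 - p₀‖ ^ 2 / ⨅ j, τ j) (fun k => sq_nonneg _)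
        fun n => ?_
      rw [le_div_iff₀ hτpos, Finset.sum_mul]
      refine (Finset.sum_le_sum fun i _ => ?_).trans (hsumr p₀ hp₀ n)
      rw [mul_comm]
      exact mul_le_mul_of_nonneg_right (ciInf_le hbdd i) (sq_nonneg _)
    have h := tendsto_succ_mul_of_antitone_of_summable hanti2 (fun k => sq_nonneg _) hs
    refine (isLittleO_iff_tendsto fun k hk => ?_).2 (h.congr fun k => ?_)
    · exact absurd hk (one_div_ne_zero (by positivity))
    · rw [div_div_eq_mul_div, div_one, mul_comm]
  · have hpF := hfix p hp
    have hAB := stepA_eq_stepB_of_isFixedPt (show Function.IsFixedPt (splittingMap γ A B C) p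
      from hpF)
    have hBA : Tendsto (fun k => stepB γ B (z k)) atTop (𝓝 (stepB γ B p)) →
        Tendsto (fun k => stepA γ A B C (z k)) atTop (𝓝 (stepB γ B p)) := fun h => by
      simpa only [hxA, add_zero] using h.add hres'
    have hRB : ∀ k, ‖stepB γ B (z k)‖ ≤ ‖z 0 - p‖ + ‖stepB γ B p‖ := fun k => by
      have h1 := norm_le_norm_sub_add (stepB γ B (z k)) (stepB γ B p)
      have h2 : ‖z k - p‖ ≤ ‖z 0 - p‖ := hfejer p hpF (Nat.zero_le k)
      linarith [norm_stepB_sub_le hB hγ0 (z k) p]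
    suffices h : Tendsto (fun k => stepB γ B (z k)) atTop (𝓝 (stepB γ B p)) from ⟨h, hBA h⟩
    rcases hcase with hc | hc | hc
    · have hRA : ∀ k, ‖stepA γ A B C (z k)‖ ≤
          (‖z 0 - p‖ + ‖stepB γ B p‖) + ‖T (z 0) - z 0‖ := fun k => by
        rw [← hxA]
        exact (norm_add_le _ _).trans (add_le_add (hRB k) (hanti (Nat.zero_le k)))
      -- Uniform monotonicity of `A` controls `x_A` first; subtracting the vanishing residual
      -- transfers the limit to `x_B`.
      have h := hc.tendsto (fun k => dualA_mem (B := B) (C := C) hA hγ0 (z k))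
        (dualA_mem hA hγ0 p) hRA (hiA p hpF)
      rw [hAB] at h
      have h' := h.sub hres'
      simp only [← hxA, add_sub_cancel_right, sub_zero] at h'
      exact h'
    · exact hc.tendsto (fun k => dualB_mem hB hγ0 (z k)) (dualB_mem hB hγ0 p) hRB (hiB p hpF)
    · exact hc _ (hzer p hpF) _ rfl _ (fun k => C (stepB γ B (z k))) (fun k => Set.mem_singleton _) (weaklyTendsto_iff.2 (hwB p hp))
        (hCp p hpF)
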